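/- Three players $1,2,3$ have nonnegative integer capitals. At each round, a pair of the players who still have positive capital is chosen uniformly at random and a fair coin flip decides which of the two transfers one unit to the other; all choices and flips are independent. A player whose capital reaches $0$ is eliminated, and play continues with the remaining players until only one of them has positive capital. Let $P_{A,B,C}$ denote the probability when players $1,2,3$ start with $A,B,C$ units, respectively, and say that player $3$ goes broke second if exactly one of the players $1,2$ is eliminated before player $3$, player $3$ is then eliminated, and the other player is never eliminated. Then, as $N\to\infty$, $$P_{1,1,N-2}(\text{player 3 goes broke second})\sim\frac{2}{N},$$ that is, $\lim_{N\to\infty}\frac{N}{2}\,P_{1,1,N-2}(\text{player 3 goes broke second})=1$. -/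

import Mathlib

namespace GamblersRuin

/-- The capitals of the three players: the players 1, 2, 3 are the indices 0, 1, 2. -/
abbrev State : Type := Fin 3 → ℕ

/-- The player `i` hands one unit to the player `j`. -/
def transfer (i j : Fin 3) (x : State) : State :=
  Function.update (Function.update x i (x i - 1)) j (x j + 1)

/-- The unordered pairs of players still in the game, each listed once with the smaller index
first. -/
def pairs (x : State) : Finset (Fin 3 × Fin 3) :=
  Finset.univ.filter fun p => p.1 < p.2 ∧ 0 < x p.1 ∧ 0 < x p.2

open Classical in
/-- One round: a pair of players still in the game is chosen uniformly at random, and a fair coin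
flip decides which of the two hands one unit to the other. Nothing happens once fewer than two
players have a positive capital. -/
noncomputable def step (x : State) : PMF State :=
  if h : (pairs x).Nonempty then
    (PMF.uniformOfFinset (pairs x) h).bind fun p =>
      (PMF.uniformOfFintype Bool).map fun heads =>
        if heads then transfer p.1 p.2 x else transfer p.2 p.1 x
  else PMF.pure x

/-- The one-round transition kernel. -/
noncomputable def stepKernel : ProbabilityTheory.Kernel State State where
  toFun x := (step x).toMeasure
  measurable' := measurable_of_countable _

instance : ProbabilityTheory.IsMarkovKernel stepKernel :=
  ⟨fun x => inferInstanceAs (MeasureTheory.IsProbabilityMeasure (step x).toMeasure)⟩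

/-- The conditional law of the state after round `n + 1` given the history up to round `n`: it
depends only on the state after round `n`. -/
noncomputable def historyKernel (n : ℕ) :
    ProbabilityTheory.Kernel (Finset.Iic n → State) State :=
  stepKernel.comap (fun history => history ⟨n, Finset.mem_Iic.2 le_rfl⟩) (measurable_pi_apply _)

instance (n : ℕ) : ProbabilityTheory.IsMarkovKernel (historyKernel n) := by
  unfold historyKernel
  infer_instance

/-- The law, on the space of trajectories, of the game with initial capitals `x`: the Markov chain
with one-round transitions `step` started at `x`. -/
noncomputable def pathLaw (x : State) : MeasureTheory.Measure (ℕ → State) :=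
  ProbabilityTheory.Kernel.trajMeasure (X := fun _ => State)
    (MeasureTheory.Measure.dirac x) historyKernel

/-- The first time at which the player `i` has no capital; it is `⊤` if this never happens. -/
noncomputable def eliminationTime (i : Fin 3) (ω : ℕ → State) : ℕ∞ :=
  ⨅ (n : ℕ) (_ : ω n i = 0), (n : ℕ∞)

/-- The event that the elimination order is `σ`: the player `σ 0` is eliminated first, the player
`σ 1` is eliminated second, and the player `σ 2` is never eliminated. -/
def eliminationOrder (σ : Equiv.Perm (Fin 3)) : Set (ℕ → State) :=
  {ω | eliminationTime (σ 0) ω < eliminationTime (σ 1) ω ∧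
    eliminationTime (σ 1) ω < ⊤ ∧ eliminationTime (σ 2) ω = ⊤}

/-- The event that the player `i` goes broke second. -/
def goesBrokeSecond (i : Fin 3) : Set (ℕ → State) :=
  {ω | ∃ σ : Equiv.Perm (Fin 3), σ 1 = i ∧ ω ∈ eliminationOrder σ}

end GamblersRuin

namespace GamblersRuin

open MeasureTheory ProbabilityTheory Finset
open scoped ENNReal

/-! Let `s` be the conserved total capital. The joint capital of players 1 and 2 is a martingale
that equals `s` once player 3 is broke, so the maximal inequality bounds the probability by `2 / N`.
For the lower bound, the game ends almost surely, and then player 3 goes broke second, wins, or is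
eliminated first. Winning has probability at most `(N - 2) / N`, because player 3's capital is a
martingale. Being eliminated first is controlled by the supermartingale `a * b * (a + b)`, with `a`,
`b` the capitals of players 1 and 2: it starts at `2` and is at least `(s - 1) * s` on that event.
Its probability is thus at most `2 / ((N - 1) * N)`, negligible against `2 / N`. -/

instance (x : State) : IsProbabilityMeasure (pathLaw x) := by
  unfold pathLaw
  infer_instance

/-! ### Markov property of the path law -/

/-- The trajectory starts almost surely at the initial state. -/
theorem ae_initial (x : State) : ∀ᵐ ω ∂pathLaw x, ω 0 = x := by
  have h : (pathLaw x).map (Preorder.frestrictLe (π := fun _ : ℕ => State) 0) =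
      (Measure.dirac x).map
        (MeasurableEquiv.piUnique (fun _ : Iic (0 : ℕ) => State)).symm := by
    rw [pathLaw, Kernel.trajMeasure, Measure.map_comp _ _ (by fun_prop),
      Kernel.traj_map_frestrictLe, Kernel.partialTraj_self, Measure.id_comp]
  replace h := h.trans (Measure.map_dirac'
    (MeasurableEquiv.piUnique (fun _ : Iic (0 : ℕ) => State)).symm.measurable x)
  have hae : ∀ᵐ y ∂(pathLaw x).map (Preorder.frestrictLe (π := fun _ : ℕ => State) 0),
      y ⟨0, by simp⟩ = x := by
    rw [h, ae_dirac_iff (Set.to_countable _).measurableSet]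
    rfl
  exact ae_of_ae_map (by fun_prop) hae

/-- The Markov property: the state after round `n + 1` is drawn from `step` given the past. -/
theorem lintegral_pathLaw_succ (x : State) (n : ℕ) (G : (Iic n → State) → State → ℝ≥0∞) :
    ∫⁻ ω, G (Preorder.frestrictLe (π := fun _ : ℕ => State) n ω) (ω (n + 1)) ∂pathLaw x =
      ∫⁻ ω, ∫⁻ y, G (Preorder.frestrictLe (π := fun _ : ℕ => State) n ω) y
        ∂(step (ω n)).toMeasure ∂pathLaw x := by
  have h := Kernel.map_frestrictLe_trajMeasure_compProd_eq_map_trajMeasure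
    (X := fun _ => State) (κ := historyKernel) (μ₀ := Measure.dirac x) (a := n)
  have hG : Measurable (Function.uncurry G) := measurable_of_countable _
  have e := congrArg (fun μ => ∫⁻ p, Function.uncurry G p ∂μ) h
  beta_reduce at e
  rw [Measure.lintegral_compProd hG, lintegral_map (measurable_of_countable _) (by fun_prop),
    lintegral_map hG (by fun_prop)] at e
  exact e.symm

theorem lintegral_pathLaw_pair (x : State) (n : ℕ) (φ : State → State → ℝ≥0∞) :
    ∫⁻ ω, φ (ω n) (ω (n + 1)) ∂pathLaw x =
      ∫⁻ ω, ∫⁻ y, φ (ω n) y ∂(step (ω n)).toMeasure ∂pathLaw x :=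
  lintegral_pathLaw_succ x n fun h => φ (h ⟨n, mem_Iic.2 le_rfl⟩)

theorem measurable_pair (φ : State → State → ℝ≥0∞) (n : ℕ) :
    Measurable fun ω : ℕ → State => φ (ω n) (ω (n + 1)) := by
  have hp : Measurable fun ω : ℕ → State => (ω n, ω (n + 1)) :=
    (measurable_pi_apply n).prodMk (measurable_pi_apply (n + 1))
  exact (measurable_of_countable (Function.uncurry φ)).comp hp

theorem ae_pair_eq_zero (x : State) (n : ℕ) (φ : State → State → ℝ≥0∞)
    (h : ∀ z, ∫⁻ y, φ z y ∂(step z).toMeasure = 0) :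
    ∀ᵐ ω ∂pathLaw x, φ (ω n) (ω (n + 1)) = 0 := by
  refine (lintegral_eq_zero_iff (measurable_pair φ n)).1 ?_
  rw [lintegral_pathLaw_pair]
  simp only [h, lintegral_zero]

/-- Almost surely, every round is a possible one. -/
theorem ae_mem_support (x : State) :
    ∀ᵐ ω ∂pathLaw x, ∀ n, ω (n + 1) ∈ (step (ω n)).support := by
  rw [ae_all_iff]
  intro n
  have h : ∀ z, ∫⁻ y, ((step z).supportᶜ).indicator 1 y ∂(step z).toMeasure = 0 := by
    intro z
    rw [lintegral_indicator_one (Set.to_countable _).measurableSet,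
      PMF.toMeasure_apply_eq_zero_iff _ (Set.to_countable _).measurableSet]
    exact disjoint_compl_right
  filter_upwards [ae_pair_eq_zero x n _ h] with ω hω
  by_contra hc
  rw [Set.indicator_of_mem hc] at hω
  exact one_ne_zero hω

/-! ### One-round means and the maximal inequality -/

/-- A sum over the pairs still in the game. -/
theorem sum_pairs {M : Type*} [AddCommMonoid M] (x : State) (φ : Fin 3 × Fin 3 → M) :
    ∑ p ∈ pairs x, φ p = (if 0 < x 0 ∧ 0 < x 1 then φ (0, 1) else 0) +
      (if 0 < x 0 ∧ 0 < x 2 then φ (0, 2) else 0) +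
      (if 0 < x 1 ∧ 0 < x 2 then φ (1, 2) else 0) := by
  simp [pairs, Finset.sum_filter, Fintype.sum_prod_type, Fin.sum_univ_three]

/-- The mean of a nonnegative function after one round. -/
theorem lintegral_step (x : State) (h : (pairs x).Nonempty) (f : State → ℝ≥0∞) :
    ∫⁻ y, f y ∂(step x).toMeasure = (#(pairs x) : ℝ≥0∞)⁻¹ * 2⁻¹ *
      ∑ p ∈ pairs x, (f (transfer p.1 p.2 x) + f (transfer p.2 p.1 x)) := by
  have hf : ∀ p : PMF State, ∫⁻ y, f y ∂p.toMeasure = ∑' y, f y * p y := by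
    intro p
    rw [lintegral_countable']
    simp [PMF.toMeasure_apply_singleton]
  have hb : ∀ y z : State, ∑' w, f w * (PMF.map (fun b : Bool => if b then y else z)
      (PMF.uniformOfFintype Bool)) w = 2⁻¹ * (f y + f z) := by
    intro y z
    rw [← hf, ← PMF.toMeasure_map _ _ (measurable_of_countable _),
      lintegral_map (measurable_of_countable _) (measurable_of_countable _), lintegral_fintype]
    simp [mul_comm, add_mul]
  rw [hf, step, dif_pos h]
  simp_rw [PMF.bind_apply, ← ENNReal.tsum_mul_left]
  rw [ENNReal.tsum_comm]
  simp only [mul_left_comm (f _), ENNReal.tsum_mul_left, hb]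
  rw [tsum_eq_sum (s := pairs x)]
  · rw [mul_assoc, mul_sum, mul_sum]
    refine sum_congr rfl fun p hp => ?_
    rw [PMF.uniformOfFinset_apply_of_mem _ hp]
  · intro p hp
    rw [PMF.uniformOfFinset_apply_of_notMem _ hp, zero_mul]

/-- The mean of `g'` after one round is at most `g`. -/
def Superharmonic (g g' : State → ℕ) : Prop :=
  ∀ x, ∫⁻ y, (g' y : ℝ≥0∞) ∂(step x).toMeasure ≤ g x

theorem superharmonic_of_sum_le {g g' : State → ℕ}
    (h : ∀ x, (pairs x).Nonempty →
      ∑ p ∈ pairs x, (g' (transfer p.1 p.2 x) + g' (transfer p.2 p.1 x)) ≤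
        ∑ _p ∈ pairs x, 2 * g x)
    (h' : ∀ x, ¬ (pairs x).Nonempty → g' x ≤ g x) : Superharmonic g g' := by
  intro x
  by_cases hx : (pairs x).Nonempty
  · have h1 := h x hx
    rw [sum_const, smul_eq_mul] at h1
    rw [lintegral_step x hx]
    have h2 : (∑ p ∈ pairs x, ((g' (transfer p.1 p.2 x) : ℝ≥0∞) + g' (transfer p.2 p.1 x))) ≤
        #(pairs x) * (2 * g x) := by exact_mod_cast h1
    have hc : (#(pairs x) : ℝ≥0∞) ≠ 0 := by simpa using hx.ne_empty
    calc _ ≤ (#(pairs x) : ℝ≥0∞)⁻¹ * 2⁻¹ * (#(pairs x) * (2 * g x)) := by gcongr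
      _ = ((#(pairs x) : ℝ≥0∞)⁻¹ * #(pairs x)) * (2⁻¹ * 2) * g x := by ring
      _ = g x := by
        rw [ENNReal.inv_mul_cancel hc (by simp), ENNReal.inv_mul_cancel (by simp) (by simp)]
        simp
  · rw [step, dif_neg hx, PMF.toMeasure_pure, lintegral_dirac]
    exact_mod_cast h' x hx

/-- The maximal inequality for nonnegative supermartingales of the game. -/
theorem maximal_inequality (x : State) (g : ℕ → State → ℕ)
    (hg : ∀ n, Superharmonic (g n) (g (n + 1))) {M : ℕ} (hM : M ≠ 0) :
    pathLaw x {ω | ∃ n, M ≤ g n (ω n)} ≤ g 0 x / M := by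
  classical
  -- The process is frozen at the value `M`, not at its own value, once it has reached `M`; this
  -- only lowers it, so its mean still does not increase.
  let U : ℕ → (ℕ → State) → ℝ≥0∞ := fun n ω =>
    if ∃ k ≤ n, M ≤ g k (ω k) then (M : ℝ≥0∞) else g n (ω n)
  have hU : ∀ n, ∫⁻ ω, U n ω ∂pathLaw x ≤ g 0 x := by
    intro n
    induction n with
    | zero =>
      calc _ ≤ ∫⁻ ω, (g 0 x : ℝ≥0∞) ∂pathLaw x := by
            apply lintegral_mono_ae
            filter_upwards [ae_initial x] with ω hω
            simp only [U]
            split_ifs with h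
            · obtain ⟨k, hk, hk'⟩ := h
              obtain rfl : k = 0 := by omega
              rw [hω] at hk'
              exact_mod_cast hk'
            · rw [hω]
        _ = _ := by simp
    | succ n ih =>
      refine le_trans ?_ ih
      have e := lintegral_pathLaw_succ x n (fun h y =>
        if ∃ k, ∃ hk : k ≤ n, M ≤ g k (h ⟨k, mem_Iic.2 hk⟩) then (M : ℝ≥0∞) else g (n + 1) y)
      simp only [Preorder.frestrictLe_apply, exists_prop] at e
      calc _ ≤ _ := ?_
        _ = _ := e
        _ ≤ _ := ?_
      · apply lintegral_mono
        intro ω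
        simp only [U]
        by_cases h : ∃ k ≤ n, M ≤ g k (ω k)
        · rw [if_pos h, if_pos]
          obtain ⟨k, hk, hk'⟩ := h
          exact ⟨k, by omega, hk'⟩
        · rw [if_neg h]
          split_ifs with h'
          · obtain ⟨k, hk, hk'⟩ := h'
            obtain rfl : k = n + 1 := by
              by_contra hne
              exact h ⟨k, by omega, hk'⟩
            exact_mod_cast hk'
          · exact le_rfl
      · apply lintegral_mono
        intro ω
        simp only [U]
        split_ifs with h
        · simp
        · exact hg n (ω n)
  have hset : {ω : ℕ → State | ∃ n, M ≤ g n (ω n)} =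
      ⋃ n, {ω : ℕ → State | ∃ k ≤ n, M ≤ g k (ω k)} := by
    ext ω
    simp only [Set.mem_ofPred_eq, Set.mem_iUnion]
    exact ⟨fun ⟨n, hn⟩ => ⟨n, n, le_rfl, hn⟩, fun ⟨_, k, _, hk⟩ => ⟨k, hk⟩⟩
  have hmono : Monotone fun n => {ω : ℕ → State | ∃ k ≤ n, M ≤ g k (ω k)} :=
    fun m n hmn ω ⟨k, hk, hk'⟩ => ⟨k, hk.trans hmn, hk'⟩
  rw [hset, hmono.measure_iUnion]
  refine iSup_le fun n => ?_
  rw [ENNReal.le_div_iff_mul_le (by simp [hM]) (by simp), mul_comm]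
  refine le_trans ?_ (hU n)
  have hmeas : MeasurableSet {ω : ℕ → State | ∃ k ≤ n, M ≤ g k (ω k)} := by
    have : {ω : ℕ → State | ∃ k ≤ n, M ≤ g k (ω k)} =
        ⋃ k, ⋃ (_ : k ≤ n), (fun ω : ℕ → State => ω k) ⁻¹' {y | M ≤ g k y} := by
      ext ω
      simp
    rw [this]
    exact MeasurableSet.iUnion fun k => MeasurableSet.iUnion fun _ =>
      (Set.to_countable _).measurableSet.preimage (measurable_pi_apply k)
  rw [← lintegral_indicator_const hmeas]
  apply lintegral_mono
  intro ω
  by_cases h : ∃ k ≤ n, M ≤ g k (ω k)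
  · simp [U, h]
  · simp [h]

/-! ### Possible rounds -/

/-- A possible round either changes nothing or moves one unit between two active players. -/
theorem mem_support_step {x y : State} (h : y ∈ (step x).support) :
    y = x ∨ ∃ i j, i ≠ j ∧ 0 < x i ∧ 0 < x j ∧ y = transfer i j x := by
  by_cases hx : (pairs x).Nonempty
  · rw [step, dif_pos hx] at h
    simp only [PMF.mem_support_bind_iff, PMF.mem_support_map_iff,
      PMF.mem_support_uniformOfFinset_iff] at h
    obtain ⟨p, hp, b, -, rfl⟩ := h
    simp only [pairs, mem_filter, mem_univ, true_and] at hp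
    right
    rcases b with _ | _
    · exact ⟨p.2, p.1, hp.1.ne', hp.2.2, hp.2.1, rfl⟩
    · exact ⟨p.1, p.2, hp.1.ne, hp.2.1, hp.2.2, rfl⟩
  · rw [step, dif_neg hx] at h
    exact Or.inl (by simpa using h)

/-- The total capital does not change. -/
theorem sum_eq_of_mem_support {x y : State} (h : y ∈ (step x).support) :
    y 0 + y 1 + y 2 = x 0 + x 1 + x 2 := by
  obtain rfl | ⟨i, j, hij, hi, hj, rfl⟩ := mem_support_step h
  · rfl
  · fin_cases i <;> fin_cases j <;> simp [transfer, Function.update] at * <;> omega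

/-- An eliminated player stays eliminated. -/
theorem eq_zero_of_mem_support {x y : State} (h : y ∈ (step x).support) {k : Fin 3}
    (hk : x k = 0) : y k = 0 := by
  obtain rfl | ⟨i, j, hij, hi, hj, rfl⟩ := mem_support_step h
  · exact hk
  · have hki : k ≠ i := by rintro rfl; omega
    have hkj : k ≠ j := by rintro rfl; omega
    simp [transfer, hki, hkj, hk]

/-- Two players are never eliminated in the same round. -/
theorem pos_or_pos_of_mem_support {x y : State} (h : y ∈ (step x).support) {k l : Fin 3}
    (hkl : k ≠ l) (hk : 0 < x k) (hl : 0 < x l) : 0 < y k ∨ 0 < y l := by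
  obtain rfl | ⟨i, j, hij, hi, hj, rfl⟩ := mem_support_step h
  · exact Or.inl hk
  · by_cases h1 : k = j
    · left; simp [transfer, h1]
    · by_cases h2 : k = i
      · right
        by_cases h3 : l = j
        · simp [transfer, h3]
        · have h4 : l ≠ i := fun h => hkl (h2.trans h.symm)
          simpa [transfer, h3, h4] using hl
      · left
        simpa [transfer, h1, h2] using hk

/-! ### The supermartingales -/

theorem superharmonic_two : Superharmonic (fun x => x 2) (fun x => x 2) := by
  apply superharmonic_of_sum_le
  · intro x _
    simp only [sum_pairs, transfer]
    rcases x 0 with _ | a <;> rcases x 1 with _ | b <;> rcases hc : x 2 with _ | c <;>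
      simp [Function.update] <;> omega
  · simp

theorem superharmonic_zero_add_one :
    Superharmonic (fun x => x 0 + x 1) (fun x => x 0 + x 1) := by
  apply superharmonic_of_sum_le
  · intro x _
    simp only [sum_pairs, transfer]
    rcases ha : x 0 with _ | a <;> rcases hb : x 1 with _ | b <;> rcases hc : x 2 with _ | c <;>
      simp [Function.update] <;> omega
  · simp

/-- With three active players the mean changes over the pairs (1,2), (1,3), (2,3) are `-(a + b)`,
`b`, `a`, which cancel. Without player 3 only the first remains; if `a` or `b` is zero, the function
stays zero. -/
theorem superharmonic_cubic :
    Superharmonic (fun x => x 0 * x 1 * (x 0 + x 1)) (fun x => x 0 * x 1 * (x 0 + x 1)) := by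
  apply superharmonic_of_sum_le
  · intro x _
    simp only [sum_pairs, transfer]
    rcases ha : x 0 with _ | a <;> rcases hb : x 1 with _ | b <;> rcases x 2 with _ | c <;>
      simp [Function.update, ha, hb] <;> ring_nf <;> omega
  · simp

/-- A fair transfer between any two active players lowers the mean of the sum of pairwise products
by exactly 1, which pays for one tick of the clock. -/
theorem superharmonic_clock (n : ℕ) :
    Superharmonic
      (fun x => x 0 * x 1 + x 0 * x 2 + x 1 * x 2 + if (pairs x).Nonempty then n else 0)
      (fun x => x 0 * x 1 + x 0 * x 2 + x 1 * x 2 +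
        if (pairs x).Nonempty then n + 1 else 0) := by
  apply superharmonic_of_sum_le
  · intro x hx
    have hle : ∀ y : State, (if (pairs y).Nonempty then n + 1 else 0) ≤ n + 1 := by
      intro y; split_ifs <;> simp
    refine (Finset.sum_le_sum fun p _ => add_le_add
      (Nat.add_le_add_left (hle _) _) (Nat.add_le_add_left (hle _) _)).trans ?_
    simp only [sum_pairs, transfer, hx, if_true]
    clear hle hx
    rcases ha : x 0 with _ | a <;> rcases hb : x 1 with _ | b <;> rcases hc : x 2 with _ | c <;>
      simp [Function.update] <;> nlinarith
  · intro x hx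
    simp [hx]

/-- The maximal inequality for a function that does not depend on time. -/
theorem measure_le_of_superharmonic (x : State) {g : State → ℕ} (hg : Superharmonic g g) {M : ℕ}
    (hM : M ≠ 0) : pathLaw x {ω | ∃ n, M ≤ g (ω n)} ≤ g x / M :=
  maximal_inequality x (fun _ => g) (fun _ => hg) hM

/-- The game ends almost surely. -/
theorem measure_never_ends (x : State) :
    pathLaw x {ω | ∀ n, (pairs (ω n)).Nonempty} = 0 := by
  classical
  set c : ℕ := x 0 * x 1 + x 0 * x 2 + x 1 * x 2 with hc
  have h : ∀ M : ℕ, M ≠ 0 →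
      pathLaw x {ω | ∀ n, (pairs (ω n)).Nonempty} ≤ (c : ℝ≥0∞) / M := by
    intro M hM
    refine (measure_mono ?_).trans ((maximal_inequality x _ superharmonic_clock hM).trans ?_)
    · intro ω hω
      -- If play still continues at time `M`, the clock alone contributes `M`.
      refine ⟨M, ?_⟩
      simp [hω M]
    · simp [hc]
  have hlim : Filter.Tendsto (fun M : ℕ => (c : ℝ≥0∞) / M) Filter.atTop (nhds 0) := by
    simpa [div_eq_mul_inv] using
      ENNReal.Tendsto.const_mul ENNReal.tendsto_inv_nat_nhds_zero
        (Or.inr (ENNReal.natCast_ne_top c))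
  refine le_antisymm (ge_of_tendsto hlim ?_) zero_le
  filter_upwards [Filter.eventually_ne_atTop 0] with M hM using h M hM

/-! ### Elimination order along a trajectory -/

/-- The properties of a trajectory that hold almost surely. -/
structure Regular (x : State) (ω : ℕ → State) : Prop where
  initial : ω 0 = x
  mem_support : ∀ n, ω (n + 1) ∈ (step (ω n)).support

theorem ae_regular (x : State) : ∀ᵐ ω ∂pathLaw x, Regular x ω := by
  filter_upwards [ae_initial x, ae_mem_support x] with ω h1 h2 using ⟨h1, h2⟩

theorem Regular.sum_eq {x : State} {ω : ℕ → State} (h : Regular x ω) (n : ℕ) :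
    ω n 0 + ω n 1 + ω n 2 = x 0 + x 1 + x 2 := by
  induction n with
  | zero => rw [h.initial]
  | succ n ih => rw [sum_eq_of_mem_support (h.mem_support n), ih]

theorem Regular.eq_zero_of_le {x : State} {ω : ℕ → State} (h : Regular x ω) {i : Fin 3} {m n : ℕ}
    (hmn : m ≤ n) (hm : ω m i = 0) : ω n i = 0 := by
  induction n, hmn using Nat.le_induction with
  | base => exact hm
  | succ n _ ih => exact eq_zero_of_mem_support (h.mem_support n) ih

theorem eliminationTime_eq_top {i : Fin 3} {ω : ℕ → State} (h : ∀ n, 0 < ω n i) :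
    eliminationTime i ω = ⊤ := by
  simp only [eliminationTime, iInf_eq_top]
  intro n hn
  exact absurd hn (h n).ne'

theorem eliminationTime_le {i : Fin 3} {ω : ℕ → State} {n : ℕ} (h : ω n i = 0) :
    eliminationTime i ω ≤ n :=
  iInf₂_le n h

theorem exists_eliminationTime_eq {i : Fin 3} {ω : ℕ → State} (h : ∃ n, ω n i = 0) :
    ∃ n : ℕ, eliminationTime i ω = n ∧ ω n i = 0 ∧ ∀ m < n, 0 < ω m i := by
  classical
  refine ⟨Nat.find h, ?_, Nat.find_spec h, fun m hm => Nat.pos_of_ne_zero (Nat.find_min h hm)⟩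
  refine le_antisymm (eliminationTime_le (Nat.find_spec h)) (le_iInf₂ fun n hn => ?_)
  exact_mod_cast Nat.find_min' h hn

theorem exists_eq_zero_of_eliminationTime_lt {i : Fin 3} {ω : ℕ → State}
    (h : eliminationTime i ω < ⊤) : ∃ n, ω n i = 0 := by
  by_contra hc
  push Not at hc
  exact h.ne (eliminationTime_eq_top fun n => Nat.pos_of_ne_zero (hc n))

/-- If player 3 loses but not first and the player `j` wins, player 3 goes broke second. -/
theorem Regular.mem_goesBrokeSecond {x : State} {ω : ℕ → State} (h : Regular x ω)
    (hx : ∀ i, 0 < x i) {i j : Fin 3} (hi : i ≠ 2) (hj : j ≠ 2) (hij : i ≠ j)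
    (hwin : ∀ n, 0 < ω n j) (hlose : ∃ n, ω n 2 = 0)
    (hfirst : ∀ n, ω n 2 = 0 → ω n i = 0) : ω ∈ goesBrokeSecond 2 := by
  obtain ⟨n, hn, hn0, hlt⟩ := exists_eliminationTime_eq hlose
  have hn1 : n ≠ 0 := by
    rintro rfl
    have := hx 2
    rw [h.initial] at hn0
    omega
  obtain ⟨k, rfl⟩ := Nat.exists_eq_succ_of_ne_zero hn1
  -- Simultaneous eliminations are impossible, so player `i` was already out one round earlier; this
  -- gives the strict inequality of times.
  have hk : ω k i = 0 := by
    by_contra hc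
    have := pos_or_pos_of_mem_support (h.mem_support k) hi (Nat.pos_of_ne_zero hc)
      (hlt k k.lt_succ_self)
    have := hfirst _ hn0
    simp only [Nat.succ_eq_add_one] at *
    omega
  have key : ∀ σ : Equiv.Perm (Fin 3), σ 0 = i → σ 1 = 2 → σ 2 = j →
      ω ∈ goesBrokeSecond 2 := by
    intro σ h0 h1 h2
    refine ⟨σ, h1, ?_, ?_, ?_⟩
    · rw [h0, h1, hn]
      exact (eliminationTime_le hk).trans_lt (by exact_mod_cast k.lt_succ_self)
    · rw [h1, hn]
      exact ENat.natCast_lt_top _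
    · rw [h2]
      exact eliminationTime_eq_top hwin
  obtain ⟨rfl, rfl⟩ | ⟨rfl, rfl⟩ : (i = 0 ∧ j = 1) ∨ (i = 1 ∧ j = 0) := by omega
  · exact key (Equiv.swap 1 2) (by decide) (by decide) (by decide)
  · exact key (Equiv.swap 0 1 * Equiv.swap 1 2) (by decide) (by decide) (by decide)

theorem Regular.mem_goesBrokeSecond_or {x : State} {ω : ℕ → State} (h : Regular x ω)
    (hx : ∀ i, 0 < x i) (hend : ∃ n, ¬ (pairs (ω n)).Nonempty) :
    ω ∈ goesBrokeSecond 2 ∨ (∃ n, x 0 + x 1 + x 2 ≤ ω n 2) ∨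
      ∃ n, ω n 2 = 0 ∧ 0 < ω n 0 ∧ 0 < ω n 1 := by
  rw [or_iff_not_imp_right]
  rintro hc
  push Not at hc
  obtain ⟨hlose, hfirst⟩ := hc
  obtain ⟨M, hM⟩ := hend
  have hM' : ∀ i j : Fin 3, i < j → 0 < ω M i → ω M j = 0 := by
    intro i j hij hi
    by_contra hj
    exact hM ⟨(i, j), by simp [pairs, hij, hi, Nat.pos_of_ne_zero hj]⟩
  have hs := h.sum_eq M
  have hx0 := hx 0
  have h01 := hM' 0 1 (by decide)
  have h02 := hM' 0 2 (by decide)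
  have h12 := hM' 1 2 (by decide)
  have hl := hlose M
  -- Otherwise player 3 would be the sole survivor at time `M` and hold the whole capital.
  have hM2 : ω M 2 = 0 := by omega
  -- Before `M` this is absorption at zero; after `M` the other two are broke, so the total would
  -- vanish.
  have hwin : ∀ j : Fin 3, j ≠ 2 → 0 < ω M j → ∀ n, 0 < ω n j := by
    intro j hj hpos n
    by_contra hn
    have hn0 : ω n j = 0 := by omega
    obtain hnM | hMn := le_total n M
    · exact hpos.ne' (h.eq_zero_of_le hnM hn0)
    · have hsn := h.sum_eq n
      have hn2 := h.eq_zero_of_le hMn hM2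
      have e0 := fun h0 => h.eq_zero_of_le (i := 0) hMn h0
      have e1 := fun h0 => h.eq_zero_of_le (i := 1) hMn h0
      obtain rfl | rfl : j = 0 ∨ j = 1 := by omega
      all_goals omega
  by_cases h0 : 0 < ω M 0
  · refine h.mem_goesBrokeSecond (i := 1) (j := 0) hx (by decide) (by decide) (by decide)
      (hwin 0 (by decide) h0) ⟨M, hM2⟩ fun n hn => ?_
    have := hfirst n hn (hwin 0 (by decide) h0 n)
    omega
  · have h1 : 0 < ω M 1 := by omega
    refine h.mem_goesBrokeSecond (i := 0) (j := 1) hx (by decide) (by decide) (by decide)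
      (hwin 1 (by decide) h1) ⟨M, hM2⟩ fun n hn => ?_
    have := hfirst n hn
    have := hwin 1 (by decide) h1 n
    omega

/-! ### Upper and lower bounds -/

/-- Player 3 goes broke with probability at most the share of the other two players. -/
theorem measure_goesBrokeSecond_le (x : State) (hx : x 0 + x 1 + x 2 ≠ 0) :
    pathLaw x (goesBrokeSecond 2) ≤ (x 0 + x 1 : ℕ) / (x 0 + x 1 + x 2 : ℕ) := by
  refine (measure_mono_ae ?_).trans
    (measure_le_of_superharmonic x superharmonic_zero_add_one hx)
  filter_upwards [ae_regular x] with ω h hω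
  obtain ⟨σ, hσ, -, hlt, -⟩ := hω
  rw [hσ] at hlt
  obtain ⟨n, hn⟩ := exists_eq_zero_of_eliminationTime_lt hlt
  have := h.sum_eq n
  exact ⟨n, show _ ≤ ω n 0 + ω n 1 by omega⟩

theorem one_le_measure_goesBrokeSecond_add (x : State) (hx : ∀ i, 0 < x i) :
    1 ≤ pathLaw x (goesBrokeSecond 2) + (x 2 / (x 0 + x 1 + x 2 : ℕ) +
      (x 0 * x 1 * (x 0 + x 1) : ℕ) /
        ((x 0 + x 1 + x 2 - 1) * (x 0 + x 1 + x 2) : ℕ)) := by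
  have h0 := hx 0
  have h1 := hx 1
  have h2 := hx 2
  set s := x 0 + x 1 + x 2 with hs
  set A : Set (ℕ → State) := {ω | ∃ n, s ≤ ω n 2}
  set B : Set (ℕ → State) := {ω | ∃ n, (s - 1) * s ≤ ω n 0 * ω n 1 * (ω n 0 + ω n 1)}
  set D : Set (ℕ → State) := {ω | ∀ n, (pairs (ω n)).Nonempty}
  have hA : pathLaw x A ≤ x 2 / s :=
    measure_le_of_superharmonic x superharmonic_two (by omega)
  have hB : pathLaw x B ≤ (x 0 * x 1 * (x 0 + x 1) : ℕ) / ((s - 1) * s : ℕ) :=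
    measure_le_of_superharmonic x superharmonic_cubic
      (mul_ne_zero (by omega) (by omega))
  have hD : pathLaw x D = 0 := measure_never_ends x
  calc (1 : ℝ≥0∞) = pathLaw x Set.univ := measure_univ.symm
    _ ≤ pathLaw x (goesBrokeSecond 2 ∪ ((A ∪ B) ∪ D)) := by
      refine measure_mono_ae ?_
      filter_upwards [ae_regular x] with ω h _
      by_cases hend : ∃ n, ¬ (pairs (ω n)).Nonempty
      · obtain h | h' | ⟨n, hn2, hn0, hn1⟩ := h.mem_goesBrokeSecond_or hx hend
        · exact Or.inl h
        · exact Or.inr (Or.inl (Or.inl h'))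
        · refine Or.inr (Or.inl (Or.inr ⟨n, ?_⟩))
          have hsn := h.sum_eq n
          rw [hn2, add_zero, ← hs] at hsn
          rw [hsn]
          -- For positive `a`, `b` with `a + b = s`, `(a - 1) * (b - 1) ≥ 0` gives `a * b ≥ s - 1`.
          refine Nat.mul_le_mul_right s ?_
          obtain ⟨a, ha⟩ := Nat.exists_eq_add_of_lt hn0
          obtain ⟨b, hb⟩ := Nat.exists_eq_add_of_lt hn1
          rw [← hsn, ha, hb]
          have : (0 + a + 1) * (0 + b + 1) = a * b + a + b + 1 := by ring
          omega
      · push Not at hend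
        exact Or.inr (Or.inr hend)
    _ ≤ pathLaw x (goesBrokeSecond 2) + (pathLaw x A + pathLaw x B) := by
      refine (measure_union_le _ _).trans (add_le_add le_rfl ?_)
      refine (measure_union_le _ _).trans ?_
      rw [hD, add_zero]
      exact measure_union_le _ _
    _ ≤ _ := by gcongr

/-- Up to the probability that player 3 is eliminated first, the probability that player 3 goes
broke second is the share of the other two players. -/
theorem goesBrokeSecond_bounds (N : ℕ) (hN : 3 ≤ N) :
    2 / (N : ℝ) - 2 / ((N - 1) * N) ≤ (pathLaw ![1, 1, N - 2]).real (goesBrokeSecond 2) ∧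
      (pathLaw ![1, 1, N - 2]).real (goesBrokeSecond 2) ≤ 2 / (N : ℝ) := by
  obtain ⟨n, rfl⟩ := Nat.exists_eq_add_of_le hN
  have hsum : 1 + 1 + (3 + n - 2) = 3 + n := by omega
  have hu := measure_goesBrokeSecond_le ![1, 1, 3 + n - 2] (by simp)
  have hl := one_le_measure_goesBrokeSecond_add ![1, 1, 3 + n - 2]
    (by intro i; fin_cases i <;> simp; omega)
  simp only [Matrix.cons_val_zero, Matrix.cons_val_one, Matrix.cons_val, hsum] at hu hl
  rw [show 3 + n - 2 = n + 1 by omega, show 3 + n - 1 = n + 2 by omega] at hl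
  rw [show 3 + n - 2 = n + 1 by omega] at hu ⊢
  set P := pathLaw ![1, 1, n + 1] (goesBrokeSecond 2)
  have hP : P ≠ ⊤ := measure_ne_top _ _
  have hu' := ENNReal.toReal_mono (by
    exact ENNReal.div_ne_top (by simp) (by simp)) hu
  have f1 : ((n + 1 : ℕ) : ℝ≥0∞) / (3 + n : ℕ) ≠ ⊤ := ENNReal.div_ne_top (by simp) (by simp)
  have f2 : ((1 * 1 * (1 + 1) : ℕ) : ℝ≥0∞) / ((n + 2) * (3 + n) : ℕ) ≠ ⊤ :=
    ENNReal.div_ne_top (by simp) (by simp)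
  have hl' := ENNReal.toReal_mono
    (ENNReal.add_ne_top.2 ⟨hP, ENNReal.add_ne_top.2 ⟨f1, f2⟩⟩) hl
  rw [ENNReal.toReal_add hP (ENNReal.add_ne_top.2 ⟨f1, f2⟩), ENNReal.toReal_add f1 f2,
    ENNReal.toReal_div, ENNReal.toReal_div] at hl'
  rw [ENNReal.toReal_div] at hu'
  simp only [ENNReal.toReal_natCast, ENNReal.toReal_one] at hl' hu'
  push_cast at hl' hu' ⊢
  refine ⟨?_, ?_⟩
  · have e : 2 / (3 + (n : ℝ)) = 1 - (n + 1) / (3 + n) := by field_simp; ring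
    rw [e, show (3 + (n : ℝ) - 1) = n + 2 by ring]
    change _ ≤ P.toReal
    linarith
  · exact hu'

end GamblersRuin

theorem mainTheorem2 :
    Asymptotics.IsEquivalent Filter.atTop
      (fun N : ℕ =>
        (GamblersRuin.pathLaw ![1, 1, N - 2]).real (GamblersRuin.goesBrokeSecond 2))
      (fun N : ℕ => 2 / (N : ℝ)) := by
  refine Asymptotics.isEquivalent_of_tendsto_one ?_
  have hlim : Filter.Tendsto (fun N : ℕ => 1 - 1 / ((N : ℝ) - 1)) Filter.atTop (nhds 1) := by
    have h : Filter.Tendsto (fun N : ℕ => (N : ℝ) - 1) Filter.atTop Filter.atTop :=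
      Filter.tendsto_atTop_add_const_right _ _ tendsto_natCast_atTop_atTop
    simpa using tendsto_const_nhds.sub (h.inv_tendsto_atTop)
  refine tendsto_of_tendsto_of_tendsto_of_le_of_le' hlim tendsto_const_nhds ?_ ?_
  · filter_upwards [Filter.eventually_ge_atTop 3] with N hN
    have hN' : (3 : ℝ) ≤ N := by exact_mod_cast hN
    have h := (GamblersRuin.goesBrokeSecond_bounds N hN).1
    have h1 : (N : ℝ) - 1 ≠ 0 := by linarith
    rw [Pi.div_apply, le_div_iff₀ (by positivity)]
    refine le_trans (le_of_eq ?_) h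
    field_simp
  · filter_upwards [Filter.eventually_ge_atTop 3] with N hN
    have hN' : (3 : ℝ) ≤ N := by exact_mod_cast hN
    rw [Pi.div_apply, div_le_one (by positivity)]
    exact (GamblersRuin.goesBrokeSecond_bounds N hN).2
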